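/- Every $x\in[-1,1]$ has an expansion $x=\sum_{n\ge 0}x_n2^{-n-1}$ with digits $x_n\in\{-1,+1\}$, which is unique unless $x$ is a dyadic rational in $(-1,1)$ (for these countably many $x$ one of the two expansions is chosen; the choice does not affect the integrals below). For $0\le n\le m$ put $L_{nm}(x)=1$ if $\sum_{j=n}^m x_j=0$ and $L_{nm}(x)=0$ otherwise. Let $\lambda$ be a complex (in particular, real) number with $|\lambda|<1$ and define $$U(x)=\sum_{0\le n\le m<\infty}\lambda^{m+1}L_{nm}(x),\qquad G(x,z)=\sum_{0\le n\le m<\infty}\lambda^{m+1}z^{x_n+\dots+x_m}\quad(|z|=1).$$ Then $U^2$ is integrable on $[-1,1]$ and, with $\sqrt{\cdot}$ the principal branch of the square root, $$\int_0^1U(x)^2dx=\frac12\int_{-1}^1U(x)^2dx=\frac1{(1-\lambda^2)(1-\lambda)^2}\left(\frac{(1-\lambda)^2}{\sqrt{1-\lambda^4}}+\frac{4\lambda}{1+(1+\lambda)\sqrt{1+\lambda^2}}+1-\lambda^2-2\sqrt{1-\lambda^2}\right).$$ Moreover, define the rational functions $$F_0(z)=\frac{4z}{2z-\lambda z^2-\lambda},\qquad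 G_0(z)=\frac{2\lambda(z^2+1)}{(1-\lambda)(2z-\lambda z^2-\lambda)},$$ $$F_1(z,w)=\frac{4zw+\lambda w(z^2+1)F_0(z)+\lambda z(w^2+1)F_0(w)}{2zw-(\lambda zw)^2-\lambda^2},$$ $$F_2(z,w)=\frac{\lambda z(w^2+1)F_0(w)+2\lambda zwG_0(w)+\lambda^2((zw)^2+1)F_1(z,w)}{(2z-(\lambda z)^2-\lambda^2)w},$$ $$G_1(z,w)=\frac{\lambda^2}{2zw(1-\lambda^2)}\Bigl(((zw)^2+1)F_1(z,w)+w(z^2+1)F_2(z,w)+z(w^2+1)F_2(w,z)\Bigr).$$ Then $\int_{-1}^1G(x,z)G(x,w)\,dx=G_1(z,w)$ for all $|z|=|w|=1$, and $$\int_{-1}^1U(x)^2dx=\frac1{(2\pi i)^2}\oint_{|w|=1}\oint_{|z|=1}\frac{G_1(z,w)}{zw}\,dz\,dw.$$ -/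

import Mathlib

noncomputable section

namespace LoopCounting

/-- The digits `x₀, x₁, x₂, … ∈ {-1, +1}` of the expansion `x = x₀/2 + x₁/2² + x₂/2³ + …` of a point
`x ∈ [-1, 1]`: the first digit is the sign of `x` and the other ones are the digits of `2x - x₀`.
The expansion is unique unless `x` is a dyadic rational in `(-1, 1)`; there this definition picks one
of the two expansions (with `x₀ = 1` for `x = 0`). -/
def digit : ℝ → ℕ → ℤ
  | x, 0 => if 0 ≤ x then 1 else -1
  | x, n + 1 => digit (2 * x - (if 0 ≤ x then 1 else -1)) n

lemma digit_eq_or (x : ℝ) (n : ℕ) : digit x n = 1 ∨ digit x n = -1 := by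
  induction n generalizing x with
  | zero => simp only [digit]; split_ifs <;> simp
  | succ n ih => exact ih _

lemma abs_sub_sum_digit_le (x : ℝ) (hx : x ∈ Set.Icc (-1 : ℝ) 1) (N : ℕ) :
    |x - ∑ n ∈ Finset.range N, (digit x n : ℝ) / 2 ^ (n + 1)| ≤ 1 / 2 ^ N := by
  induction N generalizing x with
  | zero => simpa [abs_le] using hx
  | succ N ih =>
    set y : ℝ := 2 * x - (if 0 ≤ x then 1 else -1) with hy
    have hyI : y ∈ Set.Icc (-1 : ℝ) 1 := by
      obtain ⟨h1, h2⟩ := hx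
      rw [hy]; split_ifs with h <;> constructor <;> linarith
    have h0 : ((digit x 0 : ℤ) : ℝ) = 2 * x - y := by
      rw [hy]; simp only [digit]; split_ifs <;> simp
    have hs : ∀ n, digit x (n + 1) = digit y n := fun n => rfl
    rw [Finset.sum_range_succ']
    simp only [hs, h0]
    have hsum : ∑ n ∈ Finset.range N, (digit y n : ℝ) / 2 ^ (n + 1 + 1)
        = (∑ n ∈ Finset.range N, (digit y n : ℝ) / 2 ^ (n + 1)) / 2 := by
      rw [Finset.sum_div]
      exact Finset.sum_congr rfl fun n _ => by rw [pow_succ _ (n + 1)]; ring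
    rw [hsum]
    have key := ih y hyI
    have e : x - ((∑ n ∈ Finset.range N, (digit y n : ℝ) / 2 ^ (n + 1)) / 2
        + (2 * x - y) / 2 ^ (0 + 1))
        = (y - ∑ n ∈ Finset.range N, (digit y n : ℝ) / 2 ^ (n + 1)) / 2 := by ring
    rw [e, abs_div, abs_two, pow_succ, ← div_div]
    gcongr

/-- The digits do expand `x`, at every point of `[-1, 1]`. -/
theorem hasSum_digit (x : ℝ) (hx : x ∈ Set.Icc (-1 : ℝ) 1) :
    HasSum (fun n : ℕ => (digit x n : ℝ) / 2 ^ (n + 1)) x := by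
  have hs : Summable (fun n : ℕ => (digit x n : ℝ) / 2 ^ (n + 1)) := by
    refine Summable.of_norm_bounded (g := fun n : ℕ => (1 / 2 : ℝ) ^ n)
      (summable_geometric_of_lt_one (by norm_num) (by norm_num)) fun n => ?_
    have : |(digit x n : ℝ)| = 1 := by rcases digit_eq_or x n with h | h <;> simp [h]
    rw [Real.norm_eq_abs, abs_div, this, abs_of_pos (by positivity : (0 : ℝ) < 2 ^ (n + 1)),
      div_pow, one_pow]
    gcongr
    · norm_num
    · omega
  have ht := hs.hasSum.tendsto_sum_nat
  have h0 : Filter.Tendsto (fun N : ℕ => x - ∑ n ∈ Finset.range N, (digit x n : ℝ) / 2 ^ (n + 1))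
      Filter.atTop (nhds 0) := by
    refine squeeze_zero_norm (fun N => abs_sub_sum_digit_le x hx N) ?_
    simpa [div_pow] using
      tendsto_pow_atTop_nhds_zero_of_lt_one (r := (1 / 2 : ℝ)) (by norm_num) (by norm_num)
  have h1 := tendsto_nhds_unique h0 (tendsto_const_nhds.sub ht)
  have h2 : (∑' n : ℕ, (digit x n : ℝ) / 2 ^ (n + 1)) = x := by linarith
  rw [← h2]
  simpa [h2] using hs.hasSum

/-- Away from the dyadic rationals the expansion is unique, so the digits are the ones above. -/
theorem eq_digit_of_hasSum (d : ℕ → ℤ) (hd : ∀ n, d n = 1 ∨ d n = -1) (x : ℝ)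
    (hx : ∀ (k : ℤ) (N : ℕ), x ≠ k / 2 ^ N)
    (hs : HasSum (fun n : ℕ => (d n : ℝ) / 2 ^ (n + 1)) x) (n : ℕ) : d n = digit x n := by
  -- the tail of the expansion expands `2x - x₀`
  have htail : ∀ (e : ℕ → ℤ) (y : ℝ), HasSum (fun n : ℕ => (e n : ℝ) / 2 ^ (n + 1)) y →
      HasSum (fun n : ℕ => (e (n + 1) : ℝ) / 2 ^ (n + 1)) (2 * y - e 0) := by
    intro e y h
    have h1 := ((hasSum_nat_add_iff' 1).2 h).mul_left 2
    have e1 : (2 : ℝ) * (y - ∑ i ∈ Finset.range 1, (e i : ℝ) / 2 ^ (i + 1)) = 2 * y - e 0 := by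
      simp; ring
    rw [e1] at h1
    refine h1.congr_fun fun n => ?_
    rw [pow_succ _ (n + 1)]; ring
  have hgeo : HasSum (fun n : ℕ => (1 : ℝ) / 2 ^ (n + 1)) 1 := by
    simpa [pow_succ, div_eq_mul_inv, mul_comm] using hasSum_geometric_two' 1
  have ih0 : ∀ (d : ℕ → ℤ), (∀ n, d n = 1 ∨ d n = -1) → ∀ x : ℝ,
      (∀ (k : ℤ) (N : ℕ), x ≠ k / 2 ^ N) →
      HasSum (fun n : ℕ => (d n : ℝ) / 2 ^ (n + 1)) x → d 0 = digit x 0 := by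
    intro d hd x hx hs
    have h0 : x ≠ 0 := by simpa using hx 0 0
    have ht := htail d x hs
    have hle : ∀ n : ℕ, (d (n + 1) : ℝ) ≤ 1 ∧ (-1 : ℝ) ≤ d (n + 1) := fun n => by
      rcases hd (n + 1) with h | h <;> simp [h]
    have hup : 2 * x - d 0 ≤ 1 := hasSum_le (fun n => by gcongr; exact (hle n).1) ht hgeo
    have hlo : -1 ≤ 2 * x - d 0 :=
      hasSum_le (fun n => by rw [← neg_div]; gcongr; exact (hle n).2) hgeo.neg ht
    rw [digit]
    rcases hd 0 with h | h <;> rw [h] at hup hlo ⊢ <;> push_cast at hup hlo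
    · rw [if_pos (by linarith)]
    · rw [if_neg]
      intro hx0
      exact h0 (le_antisymm (by linarith) hx0)
  induction n generalizing d x with
  | zero => exact ih0 d hd x hx hs
  | succ n ih =>
    have ht := htail d x hs
    have hy : ∀ (k : ℤ) (N : ℕ), 2 * x - (d 0 : ℝ) ≠ k / 2 ^ N := by
      intro k N h
      refine hx (k + d 0 * 2 ^ N) (N + 1) ?_
      have : (2 : ℝ) ^ N ≠ 0 := by positivity
      push_cast
      rw [pow_succ]
      field_simp
      field_simp at h
      linarith
    have key := ih (fun n => d (n + 1)) (fun n => hd (n + 1)) _ hy ht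
    have hd0 : (d 0 : ℝ) = if 0 ≤ x then 1 else -1 := by
      rw [ih0 d hd x hx hs, digit]; split_ifs <;> simp
    rw [digit, ← hd0]
    exact key

/-- The loop indicator `L_{nm}(x)`: it is `1` if `x_n + … + x_m = 0` and `0` otherwise. -/
def loopInd (n m : ℕ) (x : ℝ) : ℂ :=
  if ∑ j ∈ Finset.Icc n m, digit x j = 0 then 1 else 0

/-- The loop counting function `U(x) = ∑_{0 ≤ n ≤ m < ∞} λ^(m+1) L_{nm}(x)`
(an absolutely convergent series for `|λ| < 1`). -/
def U (lam : ℂ) (x : ℝ) : ℂ :=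
  ∑' p : ℕ × ℕ, if p.1 ≤ p.2 then lam ^ (p.2 + 1) * loopInd p.1 p.2 x else 0

/-- The generating function `G(x, z) = ∑_{0 ≤ n ≤ m < ∞} λ^(m+1) z^(x_n + … + x_m)`. -/
def G (lam : ℂ) (x : ℝ) (z : ℂ) : ℂ :=
  ∑' p : ℕ × ℕ,
    if p.1 ≤ p.2 then lam ^ (p.2 + 1) * z ^ (∑ j ∈ Finset.Icc p.1 p.2, digit x j) else 0

/-- The series over `0 ≤ n ≤ m` with terms `λ^(m+1) a_{nm}`, `|a_{nm}| ≤ 1`, converge absolutely. -/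
theorem summable_loop (lam : ℂ) (hlam : ‖lam‖ < 1) (a : ℕ → ℕ → ℂ) (ha : ∀ n m, ‖a n m‖ ≤ 1) :
    Summable fun p : ℕ × ℕ => if p.1 ≤ p.2 then lam ^ (p.2 + 1) * a p.1 p.2 else 0 := by
  obtain ⟨r, hr0, hr, hr1⟩ : ∃ r : ℝ, 0 ≤ r ∧ ‖lam‖ = r * r ∧ r < 1 := by
    refine ⟨Real.sqrt ‖lam‖, Real.sqrt_nonneg _, (Real.mul_self_sqrt (norm_nonneg _)).symm, ?_⟩
    rw [Real.sqrt_lt' one_pos]; simpa using hlam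
  have hg := summable_geometric_of_lt_one hr0 hr1
  refine Summable.of_norm_bounded
    (g := fun p : ℕ × ℕ => r ^ p.1 * r ^ p.2) (hg.mul_of_nonneg hg (fun _ => by positivity)
      (fun _ => by positivity)) fun p => ?_
  split_ifs with h
  · rw [norm_mul, norm_pow, hr, mul_pow]
    calc r ^ (p.2 + 1) * r ^ (p.2 + 1) * ‖a p.1 p.2‖
        ≤ r ^ (p.2 + 1) * r ^ (p.2 + 1) * 1 := by gcongr; exact ha _ _
      _ ≤ r ^ p.1 * r ^ p.2 := by
        rw [mul_one]
        exact mul_le_mul (pow_le_pow_of_le_one hr0 hr1.le (by omega))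
          (pow_le_pow_of_le_one hr0 hr1.le (by omega)) (by positivity) (by positivity)
  · rw [norm_zero]; positivity

/-- The rational function `4z / (2z - λz² - λ)`. -/
def ratF0 (lam z : ℂ) : ℂ := 4 * z / (2 * z - lam * z ^ 2 - lam)

/-- The rational function `2λ(z² + 1) / ((1 - λ)(2z - λz² - λ))`. -/
def ratG0 (lam z : ℂ) : ℂ :=
  2 * lam * (z ^ 2 + 1) / ((1 - lam) * (2 * z - lam * z ^ 2 - lam))

/-- The explicit rational function for `∫ F(x,z) F(x,w) dx` over `[-1, 1]`, where
`F(x, z) = 1 + ∑_{n ≥ 0} λ^(n+1) z^(x_0 + … + x_n)`. -/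
def ratF1 (lam z w : ℂ) : ℂ :=
  (4 * z * w + lam * w * (z ^ 2 + 1) * ratF0 lam z + lam * z * (w ^ 2 + 1) * ratF0 lam w) /
    (2 * z * w - (lam * z * w) ^ 2 - lam ^ 2)

/-- The explicit rational function for `∫ F(x,z) G(x,w) dx` over `[-1, 1]`. -/
def ratF2 (lam z w : ℂ) : ℂ :=
  (lam * z * (w ^ 2 + 1) * ratF0 lam w + 2 * lam * z * w * ratG0 lam w
      + lam ^ 2 * ((z * w) ^ 2 + 1) * ratF1 lam z w) /
    ((2 * z - (lam * z) ^ 2 - lam ^ 2) * w)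

/-- The explicit rational function for `∫ G(x,z) G(x,w) dx` over `[-1, 1]`. -/
def ratG1 (lam z w : ℂ) : ℂ :=
  lam ^ 2 / (2 * z * w * (1 - lam ^ 2)) *
    (((z * w) ^ 2 + 1) * ratF1 lam z w + w * (z ^ 2 + 1) * ratF2 lam z w
      + z * (w ^ 2 + 1) * ratF2 lam w z)

end LoopCounting

end

open MeasureTheory Filter Topology

/-!
Deleting the first digit maps each half of `[-1, 1]` affinely onto `[-1, 1]`, so an integral over
`[-1, 1]` is the mean over the first digit `±1` of the integrals of the two rescaled pieces. With
`F(x, z) = 1 + ∑ λ^(n+1) z^(x_0 + … + x_n)` and `x'` the shifted point, the series satisfy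
`F(x, z) = 1 + λ z^(x_0) F(x', z)` and `G(x, z) = λ (z^(x_0) F(x', z) + G(x', z))`. Averaging over
`x_0` turns these relations, and their products, into linear equations for the integrals of `F`,
`G`, `F F`, `F G` and `G G` (`integral_of_digit_recursion`); their solutions are the stated rational
functions (`integral_G_mul_G`).

Since `U(x)` is the constant Fourier coefficient of `z ↦ G(x, z)` (`circleAverage_G`), Fubini's
theorem writes `∫ U²` as the average of `ratG1` over the torus `|z| = |w| = 1`
(`integral_U_sq_eq_circleAverage`). On the torus `ratG1` is a polynomial in the resolvents
`1 / (1 - μ c)`, where `μ` is `λ` or `λ²` and `c = (u + u⁻¹) / 2` with `u = z`, `w` or `z w`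
(`ratG1_eq_resolvents`). Each resolvent is a multiple of a Poisson kernel `∑ a^|k| u^k`
(`one_div_eq_kernel`), and the convolution of two Poisson kernels is a Poisson kernel whose
parameter is the product of theirs (`hasCircleMean_kernel_mul_kernel`). So both averages are
explicit in `s = √(1 - λ²)` and `p = √(1 + λ²)`, with `√(1 - λ⁴) = s p`, and the closed form follows
from the algebraic identity `kernel_triple_one`.
-/

namespace LoopCounting

/-! ### Digits under the doubling map -/

lemma digit_zero_of_nonneg {x : ℝ} (hx : 0 ≤ x) : digit x 0 = 1 := by simp [digit, hx]

lemma digit_zero_of_neg {x : ℝ} (hx : x < 0) : digit x 0 = -1 := by simp [digit, hx.not_ge]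

/-- The doubling map that deletes the first digit. -/
noncomputable def shift (x : ℝ) : ℝ := 2 * x - (if 0 ≤ x then 1 else -1)

lemma digit_succ (x : ℝ) (n : ℕ) : digit x (n + 1) = digit (shift x) n := rfl

lemma digit_zero_upper {y : ℝ} (hy : -1 ≤ y) : digit ((y + 1) / 2) 0 = 1 :=
  digit_zero_of_nonneg (by linarith)

lemma digit_zero_lower {y : ℝ} (hy : y < 1) : digit ((y - 1) / 2) 0 = -1 :=
  digit_zero_of_neg (by linarith)

lemma shift_upper {y : ℝ} (hy : -1 ≤ y) : shift ((y + 1) / 2) = y := by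
  rw [shift, if_pos (by linarith)]; ring

lemma shift_lower {y : ℝ} (hy : y < 1) : shift ((y - 1) / 2) = y := by
  rw [shift, if_neg (by linarith)]; ring

lemma measurable_shift : Measurable shift := by
  unfold shift
  exact (measurable_const.mul measurable_id).sub
    (Measurable.ite measurableSet_Ici measurable_const measurable_const)

lemma measurable_digit (n : ℕ) : Measurable fun x => digit x n := by
  induction n with
  | zero =>
    simp only [digit]
    exact Measurable.ite measurableSet_Ici measurable_const measurable_const
  | succ n ih => exact ih.comp measurable_shift

/-- Reflection flips all digits, except possibly at dyadic rationals. -/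
lemma digit_neg_of_not_dyadic (x : ℝ) (hx : ∀ (k : ℤ) (N : ℕ), x ≠ k / 2 ^ N) (n : ℕ) :
    digit (-x) n = -digit x n := by
  induction n generalizing x with
  | zero =>
    have h0 : x ≠ 0 := by simpa using hx 0 0
    rcases lt_or_gt_of_ne h0 with h | h
    · rw [digit_zero_of_neg h, digit_zero_of_nonneg (by linarith)]; rfl
    · rw [digit_zero_of_nonneg h.le, digit_zero_of_neg (by linarith)]
  | succ n ih =>
    have h0 : x ≠ 0 := by simpa using hx 0 0
    have hs : shift (-x) = -shift x := by
      unfold shift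
      rcases lt_or_gt_of_ne h0 with h | h
      · rw [if_pos (by linarith), if_neg (by linarith)]; ring
      · rw [if_neg (by linarith), if_pos h.le]; ring
    rw [digit_succ, digit_succ, hs]
    refine ih _ fun k N h => ?_
    obtain ⟨e, he⟩ : ∃ e : ℤ, shift x = 2 * x - e := by
      unfold shift; split_ifs
      · exact ⟨1, by simp⟩
      · exact ⟨-1, by simp⟩
    refine hx (k + e * 2 ^ N) (N + 1) ?_
    rw [he] at h
    have : (2 : ℝ) ^ N ≠ 0 := by positivity
    push_cast
    rw [pow_succ]
    field_simp
    field_simp at h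
    linarith

lemma ae_not_dyadic : ∀ᵐ x : ℝ, ∀ (k : ℤ) (N : ℕ), x ≠ k / 2 ^ N := by
  rw [ae_all_iff]; intro k
  rw [ae_all_iff]; intro N
  exact Measure.ae_ne volume _

/-- Lebesgue measure on `[-1, 1]` splits evenly according to the first digit: its image under
deletion of the first digit is Lebesgue measure again on either half. -/
lemma integral_eq_half_add {f p q : ℝ → ℂ} (hf : IntervalIntegrable f volume (-1) 1)
    (hp : ∀ y, -1 ≤ y → f ((y + 1) / 2) = p y) (hq : ∀ y, y < 1 → f ((y - 1) / 2) = q y) :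
    ∫ x in (-1 : ℝ)..1, f x = ((∫ y in (-1 : ℝ)..1, p y) + ∫ y in (-1 : ℝ)..1, q y) / 2 := by
  have h1 : ∫ y in (-1 : ℝ)..1, p y = 2 * ∫ x in (0 : ℝ)..1, f x := by
    have := intervalIntegral.integral_comp_div_add (a := -1) (b := 1) f two_ne_zero (1 / 2)
    rw [show (-1 : ℝ) / 2 + 1 / 2 = 0 by norm_num, show (1 : ℝ) / 2 + 1 / 2 = 1 by norm_num,
      Complex.real_smul, Complex.ofReal_ofNat] at this
    rw [← this]
    refine intervalIntegral.integral_congr fun y hy => ?_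
    rw [Set.uIcc_of_le (by norm_num)] at hy
    rw [← hp y hy.1]; congr 1; ring
  have h2 : ∫ y in (-1 : ℝ)..1, q y = 2 * ∫ x in (-1 : ℝ)..0, f x := by
    have := intervalIntegral.integral_comp_div_sub (a := -1) (b := 1) f two_ne_zero (1 / 2)
    rw [show (-1 : ℝ) / 2 - 1 / 2 = -1 by norm_num, show (1 : ℝ) / 2 - 1 / 2 = 0 by norm_num,
      Complex.real_smul, Complex.ofReal_ofNat] at this
    rw [← this]
    refine intervalIntegral.integral_congr_ae ?_
    filter_upwards [Measure.ae_ne volume (1 : ℝ)] with y hy1 hy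
    rw [Set.uIoc_of_le (by norm_num)] at hy
    rw [← hq y (lt_of_le_of_ne hy.2 hy1)]; congr 1; ring
  have hsub : IntervalIntegrable f volume (-1) 0 ∧ IntervalIntegrable f volume 0 1 :=
    ⟨hf.mono_set (by simp [Set.uIcc_of_le]; exact Set.Icc_subset_Icc le_rfl zero_le_one),
     hf.mono_set (by simp [Set.uIcc_of_le]; exact Set.Icc_subset_Icc (by norm_num) le_rfl)⟩
  rw [← intervalIntegral.integral_add_adjacent_intervals hsub.1 hsub.2, h1, h2]; ring

lemma measurable_tsum_of_summable {α ι : Type*} [MeasurableSpace α] [Countable ι]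
    {f : ι → α → ℂ} (hf : ∀ i, Measurable (f i)) (hs : ∀ a, Summable fun i => f i a) :
    Measurable fun a => ∑' i, f i a :=
  measurable_of_tendsto_metrizable' (u := (atTop : Filter (Finset ι)))
    (f := fun s a => ∑ i ∈ s, f i a) (fun s => Finset.measurable_fun_sum s fun i _ => hf i)
    (tendsto_pi_nhds.2 fun a => (hs a).hasSum)

/-! ### The generating functions -/

/-- The generating function `F(x, z) = 1 + ∑_{n ≥ 0} λ^(n+1) z^(x_0 + … + x_n)` of the walk from
time `0`. -/
noncomputable def F (lam : ℂ) (x : ℝ) (z : ℂ) : ℂ :=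
  ∑' n : ℕ, lam ^ n * z ^ (∑ j ∈ Finset.range n, digit x j)

variable {lam z w : ℂ}

lemma norm_zpow_of_norm_eq_one (hz : ‖z‖ = 1) (k : ℤ) : ‖z ^ k‖ = 1 := by simp [hz]

lemma ne_zero_of_norm_eq_one (hz : ‖z‖ = 1) : z ≠ 0 := by
  rintro rfl; simp at hz

lemma norm_F_term (hz : ‖z‖ = 1) (x : ℝ) (n : ℕ) :
    ‖lam ^ n * z ^ (∑ j ∈ Finset.range n, digit x j)‖ = ‖lam‖ ^ n := by
  rw [norm_mul, norm_pow, norm_zpow_of_norm_eq_one hz, mul_one]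

lemma summable_F (hlam : ‖lam‖ < 1) (hz : ‖z‖ = 1) (x : ℝ) :
    Summable fun n : ℕ => lam ^ n * z ^ (∑ j ∈ Finset.range n, digit x j) :=
  .of_norm (by simpa only [norm_F_term hz] using
    summable_geometric_of_lt_one (norm_nonneg _) hlam)

lemma F_eq (hlam : ‖lam‖ < 1) (hz : ‖z‖ = 1) (x : ℝ) :
    F lam x z = 1 + lam * z ^ digit x 0 * F lam (shift x) z := by
  rw [F, (summable_F hlam hz x).tsum_eq_zero_add, F, ← tsum_mul_left]
  simp only [pow_zero, Finset.range_zero, Finset.sum_empty, zpow_zero, mul_one]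
  congr 1
  refine tsum_congr fun n => ?_
  rw [Finset.sum_range_succ', zpow_add₀ (ne_zero_of_norm_eq_one hz)]
  simp only [digit_succ]; ring

lemma summable_G (hlam : ‖lam‖ < 1) (hz : ‖z‖ = 1) (x : ℝ) :
    Summable fun p : ℕ × ℕ => if p.1 ≤ p.2 then
      lam ^ (p.2 + 1) * z ^ (∑ j ∈ Finset.Icc p.1 p.2, digit x j) else 0 :=
  summable_loop lam hlam (fun n m => z ^ (∑ j ∈ Finset.Icc n m, digit x j))
    fun _ _ => (norm_zpow_of_norm_eq_one hz _).le

lemma sum_Icc_succ_digit (x : ℝ) (n m : ℕ) :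
    ∑ j ∈ Finset.Icc (n + 1) (m + 1), digit x j = ∑ j ∈ Finset.Icc n m, digit (shift x) j := by
  rw [← Finset.map_add_right_Icc n m 1, Finset.sum_map]; rfl

lemma sum_Icc_zero_digit (x : ℝ) (m : ℕ) :
    ∑ j ∈ Finset.Icc 0 m, digit x j
      = (∑ j ∈ Finset.range m, digit (shift x) j) + digit x 0 := by
  rw [← Nat.range_succ_eq_Icc_zero, Finset.sum_range_succ']; rfl

lemma G_eq (hlam : ‖lam‖ < 1) (hz : ‖z‖ = 1) (x : ℝ) :
    G lam x z = lam * (z ^ digit x 0 * F lam (shift x) z + G lam (shift x) z) := by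
  have hs := summable_G hlam hz x
  have hs' := summable_G hlam hz (shift x)
  rw [G, hs.tsum_prod, hs.prod.tsum_eq_zero_add, mul_add]
  congr 1
  · rw [F, ← tsum_mul_left, ← tsum_mul_left]
    refine tsum_congr fun m => ?_
    rw [if_pos (Nat.zero_le _), sum_Icc_zero_digit, zpow_add₀ (ne_zero_of_norm_eq_one hz)]
    ring
  · rw [G, hs'.tsum_prod, ← tsum_mul_left]
    refine tsum_congr fun n => ?_
    rw [(hs.prod_factor (n + 1)).tsum_eq_zero_add, ← tsum_mul_left]
    simp only [nonpos_iff_eq_zero, Nat.add_eq_zero_iff, one_ne_zero, and_false, if_false, zero_add,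
      add_le_add_iff_right, sum_Icc_succ_digit]
    refine tsum_congr fun m => ?_
    split_ifs <;> ring

lemma exists_norm_F_le (hlam : ‖lam‖ < 1) :
    ∃ C, ∀ x z, ‖z‖ = 1 → ‖F lam x z‖ ≤ C :=
  ⟨∑' n : ℕ, ‖lam‖ ^ n, fun x z hz => by
    simpa only [F, norm_F_term hz] using norm_tsum_le_tsum_norm (summable_F hlam hz x).norm⟩

/-- The majorant of the loop series. -/
lemma summable_loop_bound (hlam : ‖lam‖ < 1) :
    Summable fun p : ℕ × ℕ => if p.1 ≤ p.2 then ‖lam‖ ^ (p.2 + 1) else 0 := by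
  have := (summable_loop lam hlam (fun _ _ => 1) (by simp)).norm
  refine this.congr fun p => ?_
  split_ifs <;> simp

lemma norm_loop_term_le {a : ℂ} (ha : ‖a‖ ≤ 1) (p : ℕ × ℕ) :
    ‖if p.1 ≤ p.2 then lam ^ (p.2 + 1) * a else 0‖
      ≤ if p.1 ≤ p.2 then ‖lam‖ ^ (p.2 + 1) else 0 := by
  split_ifs
  · rw [norm_mul, norm_pow]; exact mul_le_of_le_one_right (by positivity) ha
  · simp

lemma exists_norm_G_le (hlam : ‖lam‖ < 1) :
    ∃ C, ∀ x z, ‖z‖ = 1 → ‖G lam x z‖ ≤ C :=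
  ⟨_, fun _ _ hz => tsum_of_norm_bounded (summable_loop_bound hlam).hasSum fun p =>
    norm_loop_term_le (norm_zpow_of_norm_eq_one hz _).le p⟩

lemma measurable_F (hlam : ‖lam‖ < 1) (hz : ‖z‖ = 1) : Measurable fun x => F lam x z := by
  refine measurable_tsum_of_summable (fun n => measurable_const.mul ?_) (summable_F hlam hz)
  exact (measurable_of_countable fun k : ℤ => z ^ k).comp
    (Finset.measurable_fun_sum _ fun j _ => measurable_digit j)

lemma measurable_sum_digit (s : Finset ℕ) : Measurable fun x => ∑ j ∈ s, digit x j :=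
  Finset.measurable_fun_sum _ fun j _ => measurable_digit j

lemma norm_circleMap_zero_one (θ : ℝ) : ‖circleMap 0 1 θ‖ = 1 := by simp

lemma measurable_G_circleMap (hlam : ‖lam‖ < 1) :
    Measurable fun p : ℝ × ℝ => G lam p.1 (circleMap 0 1 p.2) := by
  refine measurable_tsum_of_summable (fun p => ?_)
    (fun a => summable_G hlam (norm_circleMap_zero_one a.2) a.1)
  by_cases h : p.1 ≤ p.2
  · simp only [h, if_true]
    refine measurable_const.mul ?_
    have : Measurable fun q : ℝ × ℤ => circleMap 0 1 q.1 ^ q.2 :=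
      measurable_from_prod_countable_left fun k => by
        refine Continuous.measurable ?_
        exact (continuous_circleMap 0 1).zpow₀ k
          fun θ => Or.inl (ne_zero_of_norm_eq_one (norm_circleMap_zero_one θ))
    exact Measurable.comp (g := fun q : ℝ × ℤ => circleMap 0 1 q.1 ^ q.2)
      (f := fun q : ℝ × ℝ => (q.2, ∑ j ∈ Finset.Icc p.1 p.2, digit q.1 j)) this
      (measurable_snd.prodMk ((measurable_sum_digit (Finset.Icc p.1 p.2)).comp measurable_fst))
  · simp only [h, if_false, measurable_const]

lemma exists_circleMap_eq (hz : ‖z‖ = 1) : ∃ θ : ℝ, circleMap 0 1 θ = z := by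
  have : z ∈ Set.range (circleMap 0 1) := by rw [range_circleMap]; simpa using hz
  exact this

lemma measurable_G (hlam : ‖lam‖ < 1) (hz : ‖z‖ = 1) : Measurable fun x => G lam x z := by
  obtain ⟨θ, rfl⟩ := exists_circleMap_eq hz
  exact Measurable.comp (g := fun p : ℝ × ℝ => G lam p.1 (circleMap 0 1 p.2))
    (f := fun x : ℝ => (x, θ)) (measurable_G_circleMap hlam) (measurable_id.prodMk measurable_const)

lemma intervalIntegrable_of_measurable_of_bound {f : ℝ → ℂ} (hf : Measurable f) {C : ℝ}
    (hC : ∀ x, ‖f x‖ ≤ C) (a b : ℝ) : IntervalIntegrable f volume a b :=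
  intervalIntegrable_iff.2 <| Measure.integrableOn_of_bounded
    (by simp) hf.aestronglyMeasurable (ae_of_all _ hC)

/-! ### Integrals over `[-1, 1]` of products of generating functions -/

/-- Integration of a function given by an affine relation at the shifted point, whose coefficients
depend on the first digit: the coefficients are replaced by their means. -/
lemma integral_of_digit_recursion {f f₁ f₂ f₃ f₄ : ℝ → ℂ} (a : ℂ) (b₁ b₂ b₃ b₄ : ℤ → ℂ)
    (hf : IntervalIntegrable f volume (-1) 1) (h₁ : IntervalIntegrable f₁ volume (-1) 1)
    (h₂ : IntervalIntegrable f₂ volume (-1) 1) (h₃ : IntervalIntegrable f₃ volume (-1) 1)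
    (h₄ : IntervalIntegrable f₄ volume (-1) 1)
    (H : ∀ x, f x = a + b₁ (digit x 0) * f₁ (shift x) + b₂ (digit x 0) * f₂ (shift x)
      + b₃ (digit x 0) * f₃ (shift x) + b₄ (digit x 0) * f₄ (shift x)) :
    ∫ x in (-1 : ℝ)..1, f x = 2 * a + (b₁ 1 + b₁ (-1)) / 2 * (∫ x in (-1 : ℝ)..1, f₁ x)
      + (b₂ 1 + b₂ (-1)) / 2 * (∫ x in (-1 : ℝ)..1, f₂ x)
      + (b₃ 1 + b₃ (-1)) / 2 * (∫ x in (-1 : ℝ)..1, f₃ x)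
      + (b₄ 1 + b₄ (-1)) / 2 * (∫ x in (-1 : ℝ)..1, f₄ x) := by
  have hlin : ∀ e : ℤ, ∫ y in (-1 : ℝ)..1,
      (a + b₁ e * f₁ y + b₂ e * f₂ y + b₃ e * f₃ y + b₄ e * f₄ y)
      = 2 * a + b₁ e * (∫ x in (-1 : ℝ)..1, f₁ x) + b₂ e * (∫ x in (-1 : ℝ)..1, f₂ x)
        + b₃ e * (∫ x in (-1 : ℝ)..1, f₃ x) + b₄ e * (∫ x in (-1 : ℝ)..1, f₄ x) := by
    intro e
    have h0 : IntervalIntegrable (fun _ : ℝ => a) volume (-1) 1 := intervalIntegrable_const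
    have g₁ := h₁.const_mul (b₁ e)
    have g₂ := h₂.const_mul (b₂ e)
    have g₃ := h₃.const_mul (b₃ e)
    have g₄ := h₄.const_mul (b₄ e)
    rw [intervalIntegral.integral_add (((h0.add g₁).add g₂).add g₃) g₄,
      intervalIntegral.integral_add ((h0.add g₁).add g₂) g₃,
      intervalIntegral.integral_add (h0.add g₁) g₂, intervalIntegral.integral_add h0 g₁]
    simp only [intervalIntegral.integral_const_mul, intervalIntegral.integral_const,
      Complex.real_smul]
    norm_num
  rw [integral_eq_half_add hf
    (p := fun y => a + b₁ 1 * f₁ y + b₂ 1 * f₂ y + b₃ 1 * f₃ y + b₄ 1 * f₄ y)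
    (q := fun y => a + b₁ (-1) * f₁ y + b₂ (-1) * f₂ y + b₃ (-1) * f₃ y + b₄ (-1) * f₄ y)
    (fun y hy => by rw [H, digit_zero_upper hy, shift_upper hy])
    (fun y hy => by rw [H, digit_zero_lower hy, shift_lower hy]), hlin, hlin]
  ring

lemma intervalIntegrable_F (hlam : ‖lam‖ < 1) (hz : ‖z‖ = 1) (a b : ℝ) :
    IntervalIntegrable (fun x => F lam x z) volume a b :=
  have ⟨_, hC⟩ := exists_norm_F_le hlam
  intervalIntegrable_of_measurable_of_bound (measurable_F hlam hz) (fun x => hC x z hz) a b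

lemma intervalIntegrable_G (hlam : ‖lam‖ < 1) (hz : ‖z‖ = 1) (a b : ℝ) :
    IntervalIntegrable (fun x => G lam x z) volume a b :=
  have ⟨_, hC⟩ := exists_norm_G_le hlam
  intervalIntegrable_of_measurable_of_bound (measurable_G hlam hz) (fun x => hC x z hz) a b

lemma intervalIntegrable_mul_of_bound {f g : ℝ → ℂ} (hf : Measurable f) (hg : Measurable g)
    {C D : ℝ} (hC : ∀ x, ‖f x‖ ≤ C) (hD : ∀ x, ‖g x‖ ≤ D) (a b : ℝ) :
    IntervalIntegrable (fun x => f x * g x) volume a b :=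
  intervalIntegrable_of_measurable_of_bound (C := C * D) (hf.mul hg)
    (fun x => (norm_mul _ _).trans_le (mul_le_mul (hC x) (hD x) (norm_nonneg _)
      ((norm_nonneg _).trans (hC x)))) a b

lemma intervalIntegrable_F_mul_F (hlam : ‖lam‖ < 1) (hz : ‖z‖ = 1) (hw : ‖w‖ = 1) (a b : ℝ) :
    IntervalIntegrable (fun x => F lam x z * F lam x w) volume a b :=
  have ⟨_, hC⟩ := exists_norm_F_le hlam
  intervalIntegrable_mul_of_bound (measurable_F hlam hz) (measurable_F hlam hw)
    (fun x => hC x z hz) (fun x => hC x w hw) a b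

lemma intervalIntegrable_F_mul_G (hlam : ‖lam‖ < 1) (hz : ‖z‖ = 1) (hw : ‖w‖ = 1) (a b : ℝ) :
    IntervalIntegrable (fun x => F lam x z * G lam x w) volume a b :=
  have ⟨_, hC⟩ := exists_norm_F_le hlam
  have ⟨_, hD⟩ := exists_norm_G_le hlam
  intervalIntegrable_mul_of_bound (measurable_F hlam hz) (measurable_G hlam hw)
    (fun x => hC x z hz) (fun x => hD x w hw) a b

lemma intervalIntegrable_G_mul_G (hlam : ‖lam‖ < 1) (hz : ‖z‖ = 1) (hw : ‖w‖ = 1) (a b : ℝ) :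
    IntervalIntegrable (fun x => G lam x z * G lam x w) volume a b :=
  have ⟨_, hC⟩ := exists_norm_G_le hlam
  intervalIntegrable_mul_of_bound (measurable_G hlam hz) (measurable_G hlam hw)
    (fun x => hC x z hz) (fun x => hC x w hw) a b

/-- The denominators of the rational functions do not vanish on the unit circle. -/
lemma two_mul_sub_ne_zero {μ : ℂ} (hμ : ‖μ‖ < 1) (hz : ‖z‖ = 1) :
    2 * z - μ * z ^ 2 - μ ≠ 0 := by
  intro h
  have h1 : 2 * z = μ * (z ^ 2 + 1) := by linear_combination h
  have h2 : ‖z ^ 2 + 1‖ ≤ 2 := by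
    refine (norm_add_le _ _).trans ?_
    rw [norm_pow, hz]; norm_num
  have h3 := congrArg norm h1
  rw [norm_mul, norm_mul, hz, Complex.norm_ofNat] at h3
  nlinarith [norm_nonneg μ]

lemma norm_sq_lt_one (hlam : ‖lam‖ < 1) : ‖lam ^ 2‖ < 1 := by
  rw [norm_pow]; exact pow_lt_one₀ (norm_nonneg _) hlam two_ne_zero

lemma one_sub_ne_zero_of_norm_lt_one {μ : ℂ} (hμ : ‖μ‖ < 1) : 1 - μ ≠ 0 := by
  intro h
  rw [← sub_eq_zero.1 h] at hμ
  simp at hμ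

lemma integral_F (hlam : ‖lam‖ < 1) (hz : ‖z‖ = 1) :
    ∫ x in (-1 : ℝ)..1, F lam x z = ratF0 lam z := by
  have hF := intervalIntegrable_F hlam hz (-1) 1
  have key := integral_of_digit_recursion 1 (fun e => lam * z ^ e) 0 0 0 hF hF hF hF hF
    fun x => by rw [F_eq hlam hz x]; simp
  have hz0 := ne_zero_of_norm_eq_one hz
  simp only [zpow_one, zpow_neg_one, Pi.zero_apply] at key
  rw [ratF0, eq_div_iff (two_mul_sub_ne_zero hlam hz)]
  field_simp at key
  linear_combination key

lemma integral_G (hlam : ‖lam‖ < 1) (hz : ‖z‖ = 1) :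
    ∫ x in (-1 : ℝ)..1, G lam x z = ratG0 lam z := by
  have hF := intervalIntegrable_F hlam hz (-1) 1
  have hG := intervalIntegrable_G hlam hz (-1) 1
  have key := integral_of_digit_recursion 0 (fun e => lam * z ^ e) (fun _ => lam) 0 0
    hG hF hG hF hF fun x => by rw [G_eq hlam hz x]; simp; ring
  have hz0 := ne_zero_of_norm_eq_one hz
  have hd := two_mul_sub_ne_zero hlam hz
  have hl := one_sub_ne_zero_of_norm_lt_one hlam
  have hA : ratF0 lam z * (2 * z - lam * z ^ 2 - lam) = 4 * z := div_mul_cancel₀ _ hd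
  rw [integral_F hlam hz] at key
  simp only [zpow_one, zpow_neg_one, Pi.zero_apply] at key
  rw [ratG0, eq_div_iff (mul_ne_zero hl hd)]
  field_simp at key
  refine mul_left_cancel₀ (mul_ne_zero two_ne_zero hz0) ?_
  linear_combination (2 * z - lam * z ^ 2 - lam) * key + lam * (z ^ 2 + 1) * hA

lemma integral_F_mul_F (hlam : ‖lam‖ < 1) (hz : ‖z‖ = 1) (hw : ‖w‖ = 1) :
    ∫ x in (-1 : ℝ)..1, F lam x z * F lam x w = ratF1 lam z w := by
  have hz0 := ne_zero_of_norm_eq_one hz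
  have hw0 := ne_zero_of_norm_eq_one hw
  have hFF := intervalIntegrable_F_mul_F hlam hz hw (-1) 1
  have key := integral_of_digit_recursion 1 (fun e => lam * z ^ e) (fun e => lam * w ^ e)
    (fun e => lam ^ 2 * (z * w) ^ e) 0 hFF
    (intervalIntegrable_F hlam hz (-1) 1) (intervalIntegrable_F hlam hw (-1) 1) hFF hFF
    fun x => by
      rw [F_eq hlam hz x, F_eq hlam hw x, mul_zpow]
      simp only [Pi.zero_apply, zero_mul]; ring
  have hd := two_mul_sub_ne_zero (norm_sq_lt_one hlam) (z := z * w) (by simp [hz, hw])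
  rw [integral_F hlam hz, integral_F hlam hw] at key
  simp only [zpow_one, zpow_neg_one, Pi.zero_apply] at key
  rw [ratF1, eq_div_iff (by convert hd using 1; ring)]
  field_simp at key
  linear_combination key

lemma integral_F_mul_G (hlam : ‖lam‖ < 1) (hz : ‖z‖ = 1) (hw : ‖w‖ = 1) :
    ∫ x in (-1 : ℝ)..1, F lam x z * G lam x w = ratF2 lam z w := by
  have hz0 := ne_zero_of_norm_eq_one hz
  have hw0 := ne_zero_of_norm_eq_one hw
  have hFG := intervalIntegrable_F_mul_G hlam hz hw (-1) 1
  have key := integral_of_digit_recursion 0 (fun e => lam * w ^ e) (fun _ => lam)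
    (fun e => lam ^ 2 * (z * w) ^ e) (fun e => lam ^ 2 * z ^ e) hFG
    (intervalIntegrable_F hlam hw (-1) 1) (intervalIntegrable_G hlam hw (-1) 1)
    (intervalIntegrable_F_mul_F hlam hz hw (-1) 1) hFG
    fun x => by
      rw [F_eq hlam hz x, G_eq hlam hw x, mul_zpow]; ring
  have hd := two_mul_sub_ne_zero (norm_sq_lt_one hlam) hz
  rw [integral_F hlam hw, integral_G hlam hw, integral_F_mul_F hlam hz hw] at key
  simp only [zpow_one, zpow_neg_one] at key
  rw [ratF2, eq_div_iff (mul_ne_zero (by convert hd using 1; ring) hw0)]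
  field_simp at key
  linear_combination key

lemma integral_G_mul_G (hlam : ‖lam‖ < 1) (hz : ‖z‖ = 1) (hw : ‖w‖ = 1) :
    ∫ x in (-1 : ℝ)..1, G lam x z * G lam x w = ratG1 lam z w := by
  have hz0 := ne_zero_of_norm_eq_one hz
  have hw0 := ne_zero_of_norm_eq_one hw
  have hGG := intervalIntegrable_G_mul_G hlam hz hw (-1) 1
  have key := integral_of_digit_recursion 0 (fun e => lam ^ 2 * (z * w) ^ e)
    (fun e => lam ^ 2 * z ^ e) (fun e => lam ^ 2 * w ^ e) (fun _ => lam ^ 2) hGG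
    (intervalIntegrable_F_mul_F hlam hz hw (-1) 1) (intervalIntegrable_F_mul_G hlam hz hw (-1) 1)
    (intervalIntegrable_F_mul_G hlam hw hz (-1) 1) hGG
    fun x => by
      rw [G_eq hlam hz x, G_eq hlam hw x, mul_zpow]; ring
  have hl := one_sub_ne_zero_of_norm_lt_one (norm_sq_lt_one hlam)
  rw [integral_F_mul_F hlam hz hw, integral_F_mul_G hlam hz hw, integral_F_mul_G hlam hw hz] at key
  simp only [zpow_one, zpow_neg_one] at key
  rw [ratG1, div_mul_eq_mul_div, eq_div_iff (by simp [hz0, hw0, hl])]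
  field_simp at key
  linear_combination key

/-! ### The loop counting function as a circle average -/

lemma circleAverage_zpow (k : ℤ) :
    Real.circleAverage (fun z : ℂ => z ^ k) 0 1 = if k = 0 then 1 else 0 := by
  have hpi : (2 * Real.pi * Complex.I : ℂ) ≠ 0 := by simp [Real.pi_ne_zero]
  rw [Real.circleAverage_eq_circleIntegral one_ne_zero]
  have e : (∮ z in C(0, 1), (z - 0)⁻¹ • z ^ k) = ∮ z in C((0 : ℂ), 1), (z - 0) ^ (k - 1) := by
    refine circleIntegral.integral_congr zero_le_one fun z hz => ?_
    have hz0 : z ≠ 0 := ne_zero_of_norm_eq_one (by simpa using hz)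
    simp only [sub_zero, smul_eq_mul]
    rw [zpow_sub₀ hz0, zpow_one]; field_simp
  rw [e]
  split_ifs with hk
  · simp only [hk, zero_sub, zpow_neg_one]
    rw [circleIntegral.integral_sub_center_inv 0 one_ne_zero, smul_eq_mul, inv_mul_cancel₀ hpi]
  · rw [circleIntegral.integral_sub_zpow_of_ne (by omega), smul_zero]

lemma circleAverage_G (hlam : ‖lam‖ < 1) (x : ℝ) :
    Real.circleAverage (fun z => G lam x z) 0 1 = U lam x := by
  have hpi : (2 * Real.pi : ℝ) ≠ 0 := by positivity
  let f : ℕ × ℕ → ℂ → ℂ := fun p z =>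
    if p.1 ≤ p.2 then lam ^ (p.2 + 1) * z ^ (∑ j ∈ Finset.Icc p.1 p.2, digit x j) else 0
  have hsum : HasSum (fun p => ∫ θ in (0 : ℝ)..2 * Real.pi, f p (circleMap 0 1 θ))
      (∫ θ in (0 : ℝ)..2 * Real.pi, G lam x (circleMap 0 1 θ)) := by
    refine intervalIntegral.hasSum_integral_of_dominated_convergence
      (fun p _ => if p.1 ≤ p.2 then ‖lam‖ ^ (p.2 + 1) else 0) (fun p => ?_)
      (fun p => ae_of_all _ fun θ _ =>
        norm_loop_term_le (norm_zpow_of_norm_eq_one (norm_circleMap_zero_one θ) _).le p)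
      (ae_of_all _ fun θ _ => summable_loop_bound hlam) intervalIntegrable_const
      (ae_of_all _ fun θ _ => (summable_G hlam (norm_circleMap_zero_one θ) x).hasSum)
    refine Continuous.aestronglyMeasurable ?_
    simp only [f]
    split_ifs
    · exact continuous_const.mul ((continuous_circleMap 0 1).zpow₀ _
          fun θ => Or.inl (ne_zero_of_norm_eq_one (norm_circleMap_zero_one θ)))
    · exact continuous_const
  rw [Real.circleAverage_def, ← (hsum.const_smul (2 * Real.pi)⁻¹).tsum_eq, U]
  refine tsum_congr fun p => ?_
  change Real.circleAverage (f p) 0 1 = _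
  simp only [f]
  split_ifs with h
  · have := Real.circleAverage_fun_smul (a := lam ^ (p.2 + 1)) (c := 0) (R := 1)
      (f := fun z : ℂ => z ^ (∑ j ∈ Finset.Icc p.1 p.2, digit x j))
    simp only [smul_eq_mul] at this
    rw [this, circleAverage_zpow]; rfl
  · exact Real.circleAverage_const 0 0 1

lemma summable_U (hlam : ‖lam‖ < 1) (x : ℝ) :
    Summable fun p : ℕ × ℕ => if p.1 ≤ p.2 then lam ^ (p.2 + 1) * loopInd p.1 p.2 x else 0 :=
  summable_loop lam hlam (fun n m => loopInd n m x)
    fun n m => by simp only [loopInd]; split_ifs <;> simp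

lemma measurable_U (hlam : ‖lam‖ < 1) : Measurable fun x => U lam x := by
  refine measurable_tsum_of_summable (fun p => ?_) (summable_U hlam)
  split_ifs
  · refine measurable_const.mul ?_
    exact (measurable_of_countable fun k : ℤ => if k = 0 then (1 : ℂ) else 0).comp
      (measurable_sum_digit (Finset.Icc p.1 p.2))
  · exact measurable_const

lemma exists_norm_U_le (hlam : ‖lam‖ < 1) : ∃ C, ∀ x, ‖U lam x‖ ≤ C :=
  ⟨_, fun x => tsum_of_norm_bounded (summable_loop_bound hlam).hasSum fun p =>
    norm_loop_term_le (by simp only [loopInd]; split_ifs <;> simp) p⟩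

/-- Fubini's theorem for the mean over the unit circle of bounded measurable functions. -/
lemma integral_circleAverage_swap {H : ℝ → ℂ → ℂ}
    (hm : Measurable fun p : ℝ × ℝ => H p.1 (circleMap 0 1 p.2)) {C : ℝ}
    (hC : ∀ x z, ‖z‖ = 1 → ‖H x z‖ ≤ C) (a b : ℝ) :
    ∫ x in a..b, Real.circleAverage (H x) 0 1
      = Real.circleAverage (fun z => ∫ x in a..b, H x z) 0 1 := by
  simp only [Real.circleAverage_def, intervalIntegral.integral_smul]
  rw [intervalIntegral_intervalIntegral_swap]
  refine Measure.integrableOn_of_bounded (M := C) ?_ hm.aestronglyMeasurable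
    (ae_of_all _ fun p => hC _ _ (norm_circleMap_zero_one _))
  rw [Measure.volume_eq_prod, Measure.prod_prod]
  exact ENNReal.mul_ne_top (by simp [Set.uIoc]) (by rw [Set.uIoc, Real.volume_Ioc]; finiteness)

lemma integral_U_sq_eq_circleAverage (hlam : ‖lam‖ < 1) :
    ∫ x in (-1 : ℝ)..1, U lam x ^ 2 = Real.circleAverage
      (fun w => Real.circleAverage (fun z => ratG1 lam z w) 0 1) 0 1 := by
  obtain ⟨C, hC⟩ := exists_norm_G_le hlam
  obtain ⟨D, hD⟩ := exists_norm_U_le hlam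
  have hC0 : 0 ≤ C := (norm_nonneg _).trans (hC 0 1 (by simp))
  have hD0 : 0 ≤ D := (norm_nonneg _).trans (hD 0)
  have hmul : ∀ (c : ℂ) (g : ℂ → ℂ),
      c * Real.circleAverage g 0 1 = Real.circleAverage (fun z => c * g z) 0 1 := fun c g => by
    simpa only [smul_eq_mul] using
      (Real.circleAverage_fun_smul (a := c) (c := 0) (R := 1) (f := g)).symm
  calc ∫ x in (-1 : ℝ)..1, U lam x ^ 2
      = ∫ x in (-1 : ℝ)..1, Real.circleAverage (fun w => U lam x * G lam x w) 0 1 := by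
        simp only [← hmul, circleAverage_G hlam, sq]
    _ = Real.circleAverage (fun w => ∫ x in (-1 : ℝ)..1, U lam x * G lam x w) 0 1 := by
        refine integral_circleAverage_swap (C := D * C) ?_ (fun x w hw => ?_) _ _
        · exact ((measurable_U hlam).comp measurable_fst).mul (measurable_G_circleMap hlam)
        · rw [norm_mul]; exact mul_le_mul (hD x) (hC x w hw) (norm_nonneg _) hD0
    _ = _ := by
        refine Real.circleAverage_congr_sphere fun w hw => ?_
        replace hw : ‖w‖ = 1 := by simpa using hw
        calc ∫ x in (-1 : ℝ)..1, U lam x * G lam x w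
            = ∫ x in (-1 : ℝ)..1, Real.circleAverage (fun z => G lam x w * G lam x z) 0 1 := by
              simp only [← hmul, circleAverage_G hlam, mul_comm]
          _ = Real.circleAverage (fun z => ∫ x in (-1 : ℝ)..1, G lam x w * G lam x z) 0 1 := by
              refine integral_circleAverage_swap (C := C * C) ?_ (fun x z hz => ?_) _ _
              · exact ((measurable_G hlam hw).comp measurable_fst).mul (measurable_G_circleMap hlam)
              · rw [norm_mul]; exact mul_le_mul (hC x w hw) (hC x z hz) (norm_nonneg _) hC0
          _ = Real.circleAverage (fun z => ratG1 lam z w) 0 1 := by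
              refine Real.circleAverage_congr_sphere fun z hz => ?_
              simp only [mul_comm (G lam _ w)]
              exact integral_G_mul_G hlam (by simpa using hz) hw

lemma circleAverage_circleAverage_eq (f : ℂ → ℂ → ℂ) :
    Real.circleAverage (fun w => Real.circleAverage (fun z => f z w) 0 1) 0 1
      = 1 / (2 * Real.pi * Complex.I) ^ 2 * ∮ w in C(0, 1), ∮ z in C(0, 1), f z w / (z * w) := by
  simp only [Real.circleAverage_eq_circleIntegral (one_ne_zero (α := ℝ)), smul_eq_mul, sub_zero]
  have e : ∀ w : ℂ, w⁻¹ * ((2 * Real.pi * Complex.I)⁻¹ * ∮ z in C(0, 1), z⁻¹ * f z w)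
      = (2 * Real.pi * Complex.I)⁻¹ * ∮ z in C(0, 1), f z w / (z * w) := by
    intro w
    rw [mul_left_comm, ← circleIntegral.integral_const_mul]
    congr 2
    ext z
    rw [div_eq_mul_inv, mul_inv]; ring
  simp only [e, circleIntegral.integral_const_mul]
  ring

lemma U_neg_of_not_dyadic (x : ℝ) (hx : ∀ (k : ℤ) (N : ℕ), x ≠ k / 2 ^ N) :
    U lam (-x) = U lam x := by
  simp only [U, loopInd, digit_neg_of_not_dyadic x hx, Finset.sum_neg_distrib, neg_eq_zero]

lemma intervalIntegrable_U_sq (hlam : ‖lam‖ < 1) (a b : ℝ) :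
    IntervalIntegrable (fun x => U lam x ^ 2) volume a b := by
  obtain ⟨D, hD⟩ := exists_norm_U_le hlam
  simpa only [sq] using
    intervalIntegrable_mul_of_bound (measurable_U hlam) (measurable_U hlam) hD hD a b

lemma integral_U_sq_eq_two_mul (hlam : ‖lam‖ < 1) :
    ∫ x in (-1 : ℝ)..1, U lam x ^ 2 = 2 * ∫ x in (0 : ℝ)..1, U lam x ^ 2 := by
  have hneg : ∫ x in (-1 : ℝ)..0, U lam x ^ 2 = ∫ x in (0 : ℝ)..1, U lam x ^ 2 := by
    have := intervalIntegral.integral_comp_neg (a := 0) (b := 1) fun x => U lam x ^ 2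
    rw [neg_zero] at this
    rw [← this]
    refine intervalIntegral.integral_congr_ae ?_
    filter_upwards [ae_not_dyadic] with x hx _
    rw [U_neg_of_not_dyadic x hx]
  rw [← intervalIntegral.integral_add_adjacent_intervals (intervalIntegrable_U_sq hlam _ 0)
    (intervalIntegrable_U_sq hlam _ _), hneg, two_mul]

/-! ### Averages of Poisson kernels over the unit circle -/

/-- `f` is continuous on the unit circle, with mean value `c` there. -/
def HasCircleMean (f : ℂ → ℂ) (c : ℂ) : Prop :=
  ContinuousOn f (Metric.sphere 0 1) ∧ Real.circleAverage f 0 1 = c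

namespace HasCircleMean

variable {f g : ℂ → ℂ} {c d : ℂ}

lemma circleIntegrable (hf : HasCircleMean f c) : CircleIntegrable f 0 1 :=
  hf.1.circleIntegrable zero_le_one

lemma const (c : ℂ) : HasCircleMean (fun _ => c) c :=
  ⟨continuousOn_const, Real.circleAverage_const c 0 1⟩

lemma add (hf : HasCircleMean f c) (hg : HasCircleMean g d) :
    HasCircleMean (fun z => f z + g z) (c + d) :=
  ⟨hf.1.add hg.1, by
    rw [Real.circleAverage_fun_add hf.circleIntegrable hg.circleIntegrable, hf.2, hg.2]⟩

lemma const_mul (b : ℂ) (hf : HasCircleMean f c) : HasCircleMean (fun z => b * f z) (b * c) :=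
  ⟨continuousOn_const.mul hf.1, by
    simpa only [smul_eq_mul, hf.2] using
      Real.circleAverage_fun_smul (a := b) (c := 0) (R := 1) (f := f)⟩

lemma congr (hf : HasCircleMean f c) (h : ∀ z, ‖z‖ = 1 → g z = f z) (e : c = d) :
    HasCircleMean g d := by
  refine ⟨hf.1.congr fun z hz => h z (by simpa using hz), ?_⟩
  rw [← e, ← hf.2]
  exact Real.circleAverage_congr_sphere fun z hz => h z (by simpa using hz)

lemma comp_inv (hf : HasCircleMean f c) : HasCircleMean (fun z => f z⁻¹) c := by
  refine ⟨hf.1.comp (continuousOn_id.inv₀ fun z hz => ?_) fun z hz => ?_, ?_⟩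
  · exact ne_zero_of_norm_eq_one (by simpa using hz)
  · simpa using hz
  · rw [Real.circleAverage_zero_one_congr_inv, hf.2]

/-- The mean value property. -/
lemma of_differentiableOn (hf : DifferentiableOn ℂ f (Metric.closedBall 0 1)) :
    HasCircleMean f (f 0) := by
  refine ⟨hf.continuousOn.mono Metric.sphere_subset_closedBall, ?_⟩
  refine DiffContOnCl.circleAverage ?_
  rw [abs_one]
  exact hf.diffContOnCl_ball le_rfl

/-- Cauchy's integral formula. -/
lemma cauchy (hf : DifferentiableOn ℂ f (Metric.closedBall 0 1)) {a : ℂ} (ha : ‖a‖ < 1) :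
    HasCircleMean (fun z => 1 / (1 - a * z⁻¹) * f z) (f a) := by
  have hne : ∀ z : ℂ, ‖z‖ = 1 → z - a ≠ 0 := fun z hz h => by
    rw [sub_eq_zero.1 h] at hz; exact ha.ne hz
  have h1 : ContinuousOn (fun z => ((z - 0) / (z - a)) • f z) (Metric.sphere 0 1) := by
    refine ContinuousOn.smul (ContinuousOn.div (by fun_prop) (by fun_prop)
      fun z hz => hne z (by simpa using hz)) (hf.continuousOn.mono Metric.sphere_subset_closedBall)
  have h2 : HasCircleMean (fun z => ((z - 0) / (z - a)) • f z) (f a) := by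
    refine ⟨h1, DiffContOnCl.circleAverage_smul_div ?_ (by simpa using ha)⟩
    rw [abs_one]
    exact hf.diffContOnCl_ball le_rfl
  refine h2.congr (fun z hz => ?_) rfl
  have hz0 := ne_zero_of_norm_eq_one hz
  have h3 : 1 - a * z⁻¹ ≠ 0 := by
    have := div_ne_zero (hne z hz) hz0
    rwa [sub_div, div_self hz0, div_eq_mul_inv] at this
  have := hne z hz
  rw [smul_eq_mul, sub_zero]
  field_simp

end HasCircleMean

lemma one_sub_mul_ne_zero {a : ℂ} (ha : ‖a‖ < 1) (hz : ‖z‖ ≤ 1) : 1 - a * z ≠ 0 := by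
  refine one_sub_ne_zero_of_norm_lt_one ?_
  rw [norm_mul]
  exact (mul_le_of_le_one_right (norm_nonneg _) hz).trans_lt ha

/-- The Poisson kernel `∑_{k ∈ ℤ} a^|k| z^k` of the unit circle, with a complex parameter `a` in the
unit disc, split into its parts with `k ≤ 0` and `k > 0`. -/
noncomputable def kernel (a z : ℂ) : ℂ := 1 / (1 - a * z⁻¹) + a * z / (1 - a * z)

variable {a b : ℂ}

lemma kernel_inv (ha : ‖a‖ < 1) (hz : ‖z‖ = 1) : kernel a z⁻¹ = kernel a z := by
  have h1 := one_sub_mul_ne_zero ha hz.le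
  have h2 := one_sub_mul_ne_zero ha (z := z⁻¹) (by simp [hz])
  rw [kernel, kernel, inv_inv, div_add_div _ _ h1 h2, div_add_div _ _ h2 h1,
    div_eq_div_iff (mul_ne_zero h1 h2) (mul_ne_zero h2 h1)]
  ring

lemma kernel_zero (z : ℂ) : kernel 0 z = 1 := by simp [kernel]

lemma kernel_one (a : ℂ) : kernel a 1 = (1 + a) / (1 - a) := by
  rw [kernel, inv_one, mul_one, ← add_div]

lemma differentiableOn_one_div_one_sub_mul (hb : ‖b‖ < 1) :
    DifferentiableOn ℂ (fun z => 1 / (1 - b * z)) (Metric.closedBall 0 1) :=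
  DifferentiableOn.div (by fun_prop) (by fun_prop)
    fun _ hz => one_sub_mul_ne_zero hb (by simpa using hz)

/-- Integration against the Poisson kernel evaluates a holomorphic function at the parameter. -/
lemma hasCircleMean_kernel_mul_one_div (ha : ‖a‖ < 1) (hb : ‖b‖ < 1) :
    HasCircleMean (fun z => kernel a z * (1 / (1 - b * z))) (1 / (1 - b * a)) := by
  have hd := differentiableOn_one_div_one_sub_mul hb
  have hd' : DifferentiableOn ℂ (fun z => a * z * (1 / (1 - a * z)) * (1 / (1 - b * z)))
      (Metric.closedBall 0 1) :=
    DifferentiableOn.mul (DifferentiableOn.mul (by fun_prop)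
      (differentiableOn_one_div_one_sub_mul ha)) hd
  refine ((HasCircleMean.cauchy hd ha).add (HasCircleMean.of_differentiableOn hd')).congr
    (fun z _ => ?_) (by simp)
  rw [kernel]; ring

/-- Poisson kernels form a semigroup under convolution. -/
lemma hasCircleMean_kernel_mul_kernel (ha : ‖a‖ < 1) (hb : ‖b‖ < 1) (hw : ‖w‖ = 1) :
    HasCircleMean (fun z => kernel a z * kernel b (z * w)) (kernel (a * b) w) := by
  have hw0 := ne_zero_of_norm_eq_one hw
  have hbw : ‖b * w‖ < 1 := by simpa [hw] using hb
  have hbw' : ‖b * w⁻¹‖ < 1 := by simpa [hw] using hb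
  have h1 := (hasCircleMean_kernel_mul_one_div ha hbw').comp_inv
  have h2 := hasCircleMean_kernel_mul_one_div ha hbw
  have h3 := hasCircleMean_kernel_mul_one_div (b := 0) ha (by simp)
  refine ((h1.add h2).add (h3.const_mul (-1))).congr (fun z hz => ?_) ?_
  · rw [kernel_inv ha hz]
    have h4 := one_sub_mul_ne_zero hbw hz.le
    have e : b * (z * w) / (1 - b * (z * w)) = 1 / (1 - b * w * z) - 1 := by
      rw [eq_sub_iff_add_eq, mul_comm z w, ← mul_assoc, div_add_one h4]; ring
    rw [show kernel b (z * w) = 1 / (1 - b * (z * w)⁻¹) + b * (z * w) / (1 - b * (z * w)) from rfl,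
      e, mul_inv, mul_comm z⁻¹, ← mul_assoc b]
    ring
  · have h4 := one_sub_mul_ne_zero hbw ha.le
    have e : a * b * w / (1 - a * b * w) = 1 / (1 - b * w * a) - 1 := by
      rw [eq_sub_iff_add_eq, show a * b * w = b * w * a by ring, div_add_one h4]; ring
    rw [kernel, e]
    ring

lemma hasCircleMean_kernel (ha : ‖a‖ < 1) : HasCircleMean (kernel a) 1 :=
  (hasCircleMean_kernel_mul_kernel (b := 0) (w := 1) ha (by simp) (by simp)).congr
    (fun z _ => by simp [kernel_zero]) (by simp [kernel_zero])

lemma hasCircleMean_kernel_comp_mul (hb : ‖b‖ < 1) (hw : ‖w‖ = 1) :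
    HasCircleMean (fun z => kernel b (z * w)) 1 :=
  (hasCircleMean_kernel_mul_kernel (a := 0) (by simp) hb hw).congr
    (fun z _ => by simp [kernel_zero]) (by simp [kernel_zero])

/-! ### Square roots and the step transform -/

lemma sq_sqrt (a : ℂ) : Complex.sqrt a ^ 2 = a := by
  simp [Complex.sqrt, ← Complex.cpow_nat_mul]

lemma sqrt_re_pos (ha : 0 < a.re) : 0 < (Complex.sqrt a).re := by
  rw [Complex.sqrt, Complex.cpow_inv_two_re]
  have := norm_nonneg a
  positivity

lemma eq_of_sq_eq_sq_of_re_pos (h : a ^ 2 = b ^ 2) (ha : 0 < a.re) (hb : 0 < b.re) : a = b := by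
  rcases sq_eq_sq_iff_eq_or_eq_neg.1 h with h | h
  · exact h
  · rw [h, Complex.neg_re] at ha; linarith

lemma re_mul_pos_of_re_sq_pos (ha : 0 < a.re) (hb : 0 < b.re) (ha2 : 0 < (a ^ 2).re)
    (hb2 : 0 < (b ^ 2).re) : 0 < (a * b).re := by
  rw [sq, Complex.mul_re] at ha2 hb2
  rw [Complex.mul_re]
  have h1 : |a.im| < a.re := by nlinarith [sq_abs a.im, abs_nonneg a.im]
  have h2 : |b.im| < b.re := by nlinarith [sq_abs b.im, abs_nonneg b.im]
  have h3 := mul_lt_mul'' h1 h2 (abs_nonneg _) (abs_nonneg _)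
  rw [← abs_mul] at h3
  linarith [le_abs_self (a.im * b.im)]

lemma re_one_sub_pos {μ : ℂ} (hμ : ‖μ‖ < 1) : 0 < (1 - μ).re := by
  have := (Complex.re_le_norm μ).trans_lt hμ
  simpa using this

lemma re_one_add_pos {μ : ℂ} (hμ : ‖μ‖ < 1) : 0 < (1 + μ).re := by
  simpa using re_one_sub_pos (μ := -μ) (by simpa using hμ)

lemma sqrt_one_sub_pow_four (hlam : ‖lam‖ < 1) :
    Complex.sqrt (1 - lam ^ 4) = Complex.sqrt (1 - lam ^ 2) * Complex.sqrt (1 + lam ^ 2) := by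
  have h2 := norm_sq_lt_one hlam
  have h4 : ‖lam ^ 4‖ < 1 := by
    rw [norm_pow]; exact pow_lt_one₀ (norm_nonneg _) hlam (by norm_num)
  refine eq_of_sq_eq_sq_of_re_pos ?_ (sqrt_re_pos (re_one_sub_pos h4))
    (re_mul_pos_of_re_sq_pos (sqrt_re_pos (re_one_sub_pos h2)) (sqrt_re_pos (re_one_add_pos h2))
      (by rw [sq_sqrt]; exact re_one_sub_pos h2) (by rw [sq_sqrt]; exact re_one_add_pos h2))
  rw [mul_pow, sq_sqrt, sq_sqrt, sq_sqrt]; ring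

lemma norm_div_one_add_lt_one {μ σ : ℂ} (hμ : ‖μ‖ < 1) (hσ : 0 < σ.re) : ‖μ / (1 + σ)‖ < 1 := by
  have h : 1 < ‖1 + σ‖ := by
    have := Complex.re_le_norm (1 + σ)
    rw [Complex.add_re, Complex.one_re] at this
    linarith
  rw [norm_div, div_lt_one (by linarith)]
  linarith

/-- The resolvent of the simple random walk on the Fourier side is a multiple of a Poisson
kernel. -/
lemma one_div_eq_kernel {μ σ : ℂ} (hμ : ‖μ‖ < 1) (hσ : 0 < σ.re) (h : σ ^ 2 = 1 - μ ^ 2)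
    (hz : ‖z‖ = 1) :
    1 / (1 - μ * (z + z⁻¹) / 2) = σ⁻¹ * kernel (μ / (1 + σ)) z := by
  have hr := norm_div_one_add_lt_one hμ hσ
  have hz0 := ne_zero_of_norm_eq_one hz
  have h1σ : 1 + σ ≠ 0 := fun h => by
    have := congrArg Complex.re h
    simp at this; linarith
  have hσ0 : σ ≠ 0 := by rintro rfl; simp at hσ
  obtain ⟨r, hrdef⟩ : ∃ r, r = μ / (1 + σ) := ⟨_, rfl⟩
  rw [← hrdef] at hr ⊢
  have hμr : μ = r * (1 + σ) := by rw [hrdef, div_mul_cancel₀ _ h1σ]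
  have h1 := one_sub_mul_ne_zero hr hz.le
  have h2 := one_sub_mul_ne_zero hr (z := z⁻¹) (by simp [hz])
  have hr2 : r ^ 2 * (1 + σ) = 1 - σ := by
    refine mul_right_cancel₀ h1σ ?_
    rw [hμr] at h; linear_combination h
  have e : (1 - μ * (z + z⁻¹) / 2) * 2 = (1 + σ) * ((1 - r * z⁻¹) * (1 - r * z)) := by
    rw [hμr]; field_simp; linear_combination (-z) * hr2
  have e0 : 1 - μ * (z + z⁻¹) / 2 ≠ 0 := by
    intro h0
    rw [h0, zero_mul] at e
    exact mul_ne_zero h1σ (mul_ne_zero h2 h1) e.symm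
  have e1 : kernel r z * ((1 - r * z⁻¹) * (1 - r * z)) = 1 - r ^ 2 := by
    rw [kernel, div_add_div _ _ h2 h1, div_mul_cancel₀ _ (mul_ne_zero h2 h1)]
    field_simp; ring
  rw [div_eq_iff e0, eq_comm, inv_mul_eq_div, div_mul_eq_mul_div, div_eq_iff hσ0]
  refine mul_right_cancel₀ (two_ne_zero (α := ℂ)) ?_
  linear_combination kernel r z * e + (1 + σ) * e1 - hr2

/-! ### The mean of the rational function over the torus -/

/-- The Fourier transform of one step of the walk. -/
noncomputable def stepMean (z : ℂ) : ℂ := (z + z⁻¹) / 2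

lemma one_sub_mul_stepMean_ne_zero {μ : ℂ} (hμ : ‖μ‖ < 1) (hz : ‖z‖ = 1) :
    1 - μ * stepMean z ≠ 0 := by
  have hz0 := ne_zero_of_norm_eq_one hz
  have := div_ne_zero (two_mul_sub_ne_zero hμ hz) (mul_ne_zero two_ne_zero hz0)
  convert this using 1
  rw [stepMean]; field_simp; ring

/-- `ratG1` as a polynomial in the resolvents `1 / (1 - μ c)`, `μ = λ, λ²`, of the step transforms
`c = c(z), c(w), c(z w)`. -/
lemma ratG1_eq_resolvents (hlam : ‖lam‖ < 1) (hz : ‖z‖ = 1) (hw : ‖w‖ = 1) {X Y Z W V : ℂ}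
    (hX : X = 1 / (1 - lam * stepMean z)) (hY : Y = 1 / (1 - lam * stepMean w))
    (hZ : Z = 1 / (1 - lam ^ 2 * stepMean z)) (hW : W = 1 / (1 - lam ^ 2 * stepMean w))
    (hV : V = 1 / (1 - lam ^ 2 * stepMean (z * w))) :
    ratG1 lam z w = 2 / (1 - lam ^ 2) * ((V - 1) * (X + Y - 1)
      + (Z - 1) * ((Y - 1) / (1 - lam) + (V - 1) * (X + Y - 1))
      + (W - 1) * ((X - 1) / (1 - lam) + (V - 1) * (X + Y - 1))) := by
  have hz0 := ne_zero_of_norm_eq_one hz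
  have hw0 := ne_zero_of_norm_eq_one hw
  have hzw : ‖z * w‖ = 1 := by simp [hz, hw]
  have hl2 := norm_sq_lt_one hlam
  have hl := one_sub_ne_zero_of_norm_lt_one hlam
  have hl' := one_sub_ne_zero_of_norm_lt_one hl2
  have hX' : X * (1 - lam * stepMean z) = 1 := by
    rw [hX, one_div_mul_cancel (one_sub_mul_stepMean_ne_zero hlam hz)]
  have hY' : Y * (1 - lam * stepMean w) = 1 := by
    rw [hY, one_div_mul_cancel (one_sub_mul_stepMean_ne_zero hlam hw)]
  have hZ' : Z * (1 - lam ^ 2 * stepMean z) = 1 := by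
    rw [hZ, one_div_mul_cancel (one_sub_mul_stepMean_ne_zero hl2 hz)]
  have hW' : W * (1 - lam ^ 2 * stepMean w) = 1 := by
    rw [hW, one_div_mul_cancel (one_sub_mul_stepMean_ne_zero hl2 hw)]
  have hV' : V * (1 - lam ^ 2 * stepMean (z * w)) = 1 := by
    rw [hV, one_div_mul_cancel (one_sub_mul_stepMean_ne_zero hl2 hzw)]
  clear hX hY hZ hW hV
  have cz : z ^ 2 + 1 = 2 * z * stepMean z := by rw [stepMean]; field_simp
  have cw : w ^ 2 + 1 = 2 * w * stepMean w := by rw [stepMean]; field_simp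
  have czw : (z * w) ^ 2 + 1 = 2 * z * w * stepMean (z * w) := by rw [stepMean]; field_simp
  have hF0 : ∀ u R : ℂ, ‖u‖ = 1 → u ^ 2 + 1 = 2 * u * stepMean u →
      R * (1 - lam * stepMean u) = 1 → ratF0 lam u = 2 * R := by
    intro u R hu cu hR
    rw [ratF0, div_eq_iff (two_mul_sub_ne_zero hlam hu)]
    linear_combination (-4 * u) * hR + 2 * R * lam * cu
  have hFz := hF0 z X hz cz hX'
  have hFw := hF0 w Y hw cw hY'
  have hG0 : ∀ u R : ℂ, ‖u‖ = 1 → u ^ 2 + 1 = 2 * u * stepMean u →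
      R * (1 - lam * stepMean u) = 1 → ratG0 lam u = 2 * (R - 1) / (1 - lam) := by
    intro u R hu cu hR
    rw [ratG0, div_eq_div_iff (mul_ne_zero hl (two_mul_sub_ne_zero hlam hu)) hl]
    linear_combination (1 - lam) * ((-4 * u) * hR + 2 * R * lam * cu)
  have hGz := hG0 z X hz cz hX'
  have hGw := hG0 w Y hw cw hY'
  have hF1 : ∀ u v R S : ℂ, ‖u‖ = 1 → ‖v‖ = 1 → u ^ 2 + 1 = 2 * u * stepMean u →
      v ^ 2 + 1 = 2 * v * stepMean v → (u * v) ^ 2 + 1 = 2 * u * v * stepMean (u * v) →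
      R * (1 - lam * stepMean u) = 1 → S * (1 - lam * stepMean v) = 1 →
      V * (1 - lam ^ 2 * stepMean (u * v)) = 1 →
      ratF0 lam u = 2 * R → ratF0 lam v = 2 * S →
      ratF1 lam u v = 2 * (R + S - 1) * V := by
    intro u v R S hu hv cu cv cuv hR hS hV hFu hFv
    have hd := two_mul_sub_ne_zero hl2 (z := u * v) (by simp [hu, hv])
    rw [ratF1, hFu, hFv, div_eq_iff (by convert hd using 1; ring)]
    linear_combination 2 * lam * v * R * cu + 2 * lam * u * S * cv - 4 * u * v * hR
      - 4 * u * v * hS + 2 * (R + S - 1) * V * lam ^ 2 * cuv - 4 * u * v * (R + S - 1) * hV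
  have hF1zw := hF1 z w X Y hz hw cz cw czw hX' hY' hV' hFz hFw
  have hF1wz := hF1 w z Y X hw hz cw cz (by rw [mul_comm w z, czw]; ring) hY' hX'
    (by rwa [mul_comm w z]) hFw hFz
  have hF2 : ∀ u v R S T : ℂ, ‖u‖ = 1 → ‖v‖ = 1 → u ^ 2 + 1 = 2 * u * stepMean u →
      v ^ 2 + 1 = 2 * v * stepMean v → (u * v) ^ 2 + 1 = 2 * u * v * stepMean (u * v) →
      S * (1 - lam * stepMean v) = 1 →
      V * (1 - lam ^ 2 * stepMean (u * v)) = 1 → T * (1 - lam ^ 2 * stepMean u) = 1 →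
      ratF0 lam v = 2 * S → ratG0 lam v = 2 * (S - 1) / (1 - lam) →
      ratF1 lam u v = 2 * (R + S - 1) * V →
      ratF2 lam u v = 2 * ((S - 1) / (1 - lam) + (V - 1) * (R + S - 1)) * T := by
    intro u v R S T hu hv cu cv cuv hS hV hT hFv hGv hF1
    have hv0 := ne_zero_of_norm_eq_one hv
    have hd := two_mul_sub_ne_zero hl2 hu
    have e : (S - 1) / (1 - lam) = (S - 1) + lam * ((S - 1) / (1 - lam)) := by
      field_simp; ring
    obtain ⟨Q, hQ⟩ : ∃ Q, Q = (S - 1) / (1 - lam) := ⟨_, rfl⟩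
    rw [mul_div_assoc] at hGv
    rw [← hQ] at e hGv ⊢
    rw [ratF2, hFv, hGv, hF1, div_eq_iff (mul_ne_zero (by convert hd using 1; ring) hv0)]
    linear_combination 2 * lam * u * S * cv + 2 * lam ^ 2 * (R + S - 1) * V * cuv
      + 2 * (Q + (V - 1) * (R + S - 1)) * T * v * lam ^ 2 * cu
      - 4 * u * v * (Q + (V - 1) * (R + S - 1)) * hT - 4 * u * v * e
      - 4 * u * v * hS - 4 * u * v * (R + S - 1) * hV
  have hF2zw := hF2 z w X Y Z hz hw cz cw czw hY' hV' hZ' hFw hGw hF1zw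
  have hF2wz := hF2 w z Y X W hw hz cw cz (by rw [mul_comm w z, czw]; ring) hX'
    (by rwa [mul_comm w z]) hW' hFz hGz hF1wz
  obtain ⟨Q, hQ⟩ : ∃ Q, Q = (X - 1) / (1 - lam) := ⟨_, rfl⟩
  obtain ⟨Q', hQ'⟩ : ∃ Q, Q = (Y - 1) / (1 - lam) := ⟨_, rfl⟩
  rw [← hQ] at hF2wz ⊢
  rw [← hQ'] at hF2zw ⊢
  rw [ratG1, hF1zw, hF2zw, hF2wz, czw, cz, cw]
  field_simp
  linear_combination (-(X + Y - 1)) * hV' - (Q' + (V - 1) * (X + Y - 1)) * hZ'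
    - (Q + (V - 1) * (X + Y - 1)) * hW'

/-- Partial fractions. -/
lemma resolvent_mul_resolvent (hlam : ‖lam‖ < 1) (hz : ‖z‖ = 1) :
    1 / (1 - lam * stepMean z) * (1 / (1 - lam ^ 2 * stepMean z))
      = (1 / (1 - lam * stepMean z) - lam * (1 / (1 - lam ^ 2 * stepMean z))) / (1 - lam) := by
  have h1 := one_sub_mul_stepMean_ne_zero hlam hz
  have h2 := one_sub_mul_stepMean_ne_zero (norm_sq_lt_one hlam) hz
  have h3 := one_sub_ne_zero_of_norm_lt_one hlam
  rw [eq_div_iff h3]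
  field_simp
  ring

/-- The value at `1` of the Poisson kernel that comes from the convolution of all three kernels. -/
lemma kernel_triple_one {s p : ℂ} (hs : s ^ 2 = 1 - lam ^ 2) (hp : p ^ 2 = 1 + lam ^ 2)
    (hs0 : s ≠ 0) (h1s : 1 + s ≠ 0) (h1sp : 1 + s * p ≠ 0) (hE : 1 + (1 + lam) * p ≠ 0)
    (hR : ‖lam / (1 + s) * (lam ^ 2 / (1 + s * p)) * (lam ^ 2 / (1 + s * p))‖ < 1) :
    kernel (lam / (1 + s) * (lam ^ 2 / (1 + s * p)) * (lam ^ 2 / (1 + s * p))) 1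
      = (1 + lam) * (1 + (1 - lam) * p) / (s * (1 + (1 + lam) * p)) := by
  have hR' := one_sub_ne_zero_of_norm_lt_one hR
  have e : lam / (1 + s) * (lam ^ 2 / (1 + s * p)) * (lam ^ 2 / (1 + s * p))
      = lam ^ 5 / ((1 + s * p) ^ 2 * (1 + s)) := by
    field_simp
  have hD : (1 + s * p) ^ 2 * (1 + s) ≠ 0 := mul_ne_zero (pow_ne_zero 2 h1sp) h1s
  rw [kernel_one, div_eq_div_iff hR' (mul_ne_zero hs0 hE), e]
  field_simp
  linear_combination (1 + (1 - lam) * p + lam * (1 + lam) * p ^ 2 + lam * (1 - lam ^ 2) * p ^ 3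
      + 2 * s * p + (2 + lam) * s * p ^ 2 + lam * (1 + lam) * s * p ^ 3 + s ^ 2 * p ^ 2
      + (1 + lam) * s ^ 2 * p ^ 3) * hs
    + (lam * (1 + lam) * (1 - lam ^ 2) + lam * (1 - lam ^ 2) ^ 2 * p + lam * (1 - lam ^ 2) * s
      + lam * (1 + lam) * (1 - lam ^ 2) * s * p) * hp

/-- The denominator in the closed form does not vanish. -/
lemma one_add_mul_ne_zero {p : ℂ} (hlam : ‖lam‖ < 1) (hp0 : 0 < p.re)
    (hp : p ^ 2 = 1 + lam ^ 2) : 1 + (1 + lam) * p ≠ 0 := by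
  intro h
  have h1 : lam * (lam ^ 3 + 2 * lam ^ 2 + 2 * lam + 2) = 0 := by
    linear_combination ((1 + lam) * p - 1) * h - (1 + lam) ^ 2 * hp
  rcases mul_eq_zero.1 h1 with h0 | h0
  · rw [h0] at h
    have : p = -1 := by linear_combination h
    rw [this] at hp0
    norm_num at hp0
  · -- multiplication by `1 - λ` shows that the cubic factor has no zero in the unit disc
    have h2 : (2 : ℂ) = lam ^ 3 + lam ^ 4 := by linear_combination (1 - lam) * h0
    have h3 := congrArg norm h2
    rw [Complex.norm_ofNat] at h3
    have h4 := norm_add_le (lam ^ 3) (lam ^ 4)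
    rw [norm_pow, norm_pow] at h4
    have h5 : ‖lam‖ ^ 3 < 1 := pow_lt_one₀ (norm_nonneg _) hlam (by norm_num)
    have h6 : ‖lam‖ ^ 4 < 1 := pow_lt_one₀ (norm_nonneg _) hlam (by norm_num)
    linarith

/-- The inner average of `ratG1`: with `w` fixed, every product of resolvents averages to a Poisson
kernel in `w`. Here `s = √(1 - λ²)` and `t = √(1 - λ⁴)`. -/
lemma hasCircleMean_ratG1 (hlam : ‖lam‖ < 1) (hw : ‖w‖ = 1) {s t r ρ Y W : ℂ}
    (hs : s ^ 2 = 1 - lam ^ 2) (hs0 : 0 < s.re) (ht : t ^ 2 = 1 - (lam ^ 2) ^ 2) (ht0 : 0 < t.re)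
    (hr : r = lam / (1 + s)) (hρ : ρ = lam ^ 2 / (1 + t))
    (hY : Y = 1 / (1 - lam * stepMean w)) (hW : W = 1 / (1 - lam ^ 2 * stepMean w)) :
    HasCircleMean (fun z => ratG1 lam z w) (2 / (1 - lam ^ 2) *
      ((1 / (1 - lam) + (W - 1)) * (s⁻¹ * t⁻¹ * kernel (r * ρ) w)
        + (Y - 1 - lam / (1 - lam)) * (t⁻¹ ^ 2 * kernel (ρ * ρ) w)
        + ((W - 1) * (Y - 1) * t⁻¹ + ((W - 1) * lam - 1) / (1 - lam) * s⁻¹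
          + lam * Y / (1 - lam) * t⁻¹
          - (Y - 1 + (W - 1)) / (1 - lam) - (W - 1) * (Y - 1)))) := by
  have hl2 := norm_sq_lt_one hlam
  have hl := one_sub_ne_zero_of_norm_lt_one hlam
  have hrn : ‖r‖ < 1 := hr ▸ norm_div_one_add_lt_one hlam hs0
  have hρn : ‖ρ‖ < 1 := hρ ▸ norm_div_one_add_lt_one hl2 ht0
  have hX : ∀ z : ℂ, ‖z‖ = 1 → 1 / (1 - lam * stepMean z) = s⁻¹ * kernel r z := fun z hz => by
    rw [hr, ← one_div_eq_kernel hlam hs0 hs hz, stepMean, mul_div_assoc]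
  have hZ : ∀ z : ℂ, ‖z‖ = 1 → 1 / (1 - lam ^ 2 * stepMean z) = t⁻¹ * kernel ρ z := fun z hz => by
    rw [hρ, ← one_div_eq_kernel hl2 ht0 ht hz, stepMean, mul_div_assoc]
  -- the averages of the elementary products
  have mVX := (hasCircleMean_kernel_mul_kernel hrn hρn hw).const_mul (s⁻¹ * t⁻¹)
  have mVZ := (hasCircleMean_kernel_mul_kernel hρn hρn hw).const_mul (t⁻¹ ^ 2)
  have mV := (hasCircleMean_kernel_comp_mul hρn hw).const_mul t⁻¹
  have mX := (hasCircleMean_kernel hrn).const_mul s⁻¹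
  have mZ := (hasCircleMean_kernel hρn).const_mul t⁻¹
  refine (((((((mVX.const_mul (1 / (1 - lam) + (W - 1))).add
    (mVZ.const_mul (Y - 1 - lam / (1 - lam)))).add
    (mV.const_mul ((W - 1) * (Y - 1)))).add
    (mX.const_mul (((W - 1) * lam - 1) / (1 - lam)))).add
    (mZ.const_mul (lam * Y / (1 - lam)))).add
    (HasCircleMean.const (-(Y - 1 + (W - 1)) / (1 - lam) - (W - 1) * (Y - 1)))).const_mul
    (2 / (1 - lam ^ 2))).congr (fun z hz => ?_) (by ring)
  -- partial fractions replace the product of the two resolvents at `z`, so that the product of all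
  -- three resolvents becomes a combination of convolutions
  have hpf := resolvent_mul_resolvent hlam hz
  rw [hX z hz, hZ z hz] at hpf
  rw [ratG1_eq_resolvents hlam hz hw (hX z hz).symm hY (hZ z hz).symm hW
    (hZ (z * w) (by simp [hz, hw])).symm]
  congr 1
  obtain ⟨x, hx⟩ : ∃ x, x = s⁻¹ * kernel r z := ⟨_, rfl⟩
  obtain ⟨y, hy⟩ : ∃ y, y = t⁻¹ * kernel ρ z := ⟨_, rfl⟩
  obtain ⟨v, hv⟩ : ∃ v, v = t⁻¹ * kernel ρ (z * w) := ⟨_, rfl⟩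
  have e1 : s⁻¹ * t⁻¹ * (kernel r z * kernel ρ (z * w)) = v * x := by rw [hx, hv]; ring
  have e2 : t⁻¹ ^ 2 * (kernel ρ z * kernel ρ (z * w)) = v * y := by rw [hy, hv]; ring
  rw [e1, e2]
  rw [← hx, ← hy] at hpf ⊢
  rw [← hv]
  rw [eq_div_iff hl] at hpf
  field_simp
  linear_combination (v - 1) * hpf

/-- The mean of `ratG1` over the torus. After the three kernels have been convolved, only the value
`kernel (r * ρ * ρ) 1` is not immediate, and `kernel_triple_one` gives it. -/
lemma circleAverage_circleAverage_ratG1 (hlam : ‖lam‖ < 1) {s p : ℂ}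
    (hs : s ^ 2 = 1 - lam ^ 2) (hs0 : 0 < s.re) (hp : p ^ 2 = 1 + lam ^ 2) (hp0 : 0 < p.re)
    (hsp0 : 0 < (s * p).re) :
    Real.circleAverage (fun w => Real.circleAverage (fun z => ratG1 lam z w) 0 1) 0 1
      = 2 / ((1 - lam ^ 2) * (1 - lam) ^ 2) *
        ((1 - lam) ^ 2 / (s * p) + 4 * lam / (1 + (1 + lam) * p) + (1 - lam ^ 2) - 2 * s) := by
  have hl2 := norm_sq_lt_one hlam
  have hl := one_sub_ne_zero_of_norm_lt_one hlam
  have hl' := one_sub_ne_zero_of_norm_lt_one hl2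
  have ne_of_re : ∀ a : ℂ, 0 < a.re → a ≠ 0 := by rintro a h rfl; simp at h
  have hsne := ne_of_re s hs0
  have hpne := ne_of_re p hp0
  have h1s := ne_of_re (1 + s) (by simp; linarith)
  have h1sp := ne_of_re (1 + s * p) (by rw [Complex.add_re, Complex.one_re]; linarith)
  have hE := one_add_mul_ne_zero hlam hp0 hp
  have ht : (s * p) ^ 2 = 1 - (lam ^ 2) ^ 2 := by rw [mul_pow, hs, hp]; ring
  obtain ⟨t, htdef⟩ : ∃ t, t = s * p := ⟨_, rfl⟩
  obtain ⟨r, hr⟩ : ∃ r, r = lam / (1 + s) := ⟨_, rfl⟩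
  obtain ⟨ρ, hρ⟩ : ∃ ρ, ρ = lam ^ 2 / (1 + t) := ⟨_, rfl⟩
  rw [← htdef] at hsp0 ht h1sp
  have hrn : ‖r‖ < 1 := hr ▸ norm_div_one_add_lt_one hlam hs0
  have hρn : ‖ρ‖ < 1 := hρ ▸ norm_div_one_add_lt_one hl2 hsp0
  have hmul : ∀ {a b : ℂ}, ‖a‖ < 1 → ‖b‖ < 1 → ‖a * b‖ < 1 := fun ha hb => by
    rw [norm_mul]; exact mul_lt_one_of_nonneg_of_lt_one_left (norm_nonneg _) ha hb.le
  have hY : ∀ z : ℂ, ‖z‖ = 1 → 1 / (1 - lam * stepMean z) = s⁻¹ * kernel r z := fun z hz => by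
    rw [hr, ← one_div_eq_kernel hlam hs0 hs hz, stepMean, mul_div_assoc]
  have hW : ∀ z : ℂ, ‖z‖ = 1 → 1 / (1 - lam ^ 2 * stepMean z) = t⁻¹ * kernel ρ z := fun z hz => by
    rw [hρ, ← one_div_eq_kernel hl2 hsp0 ht hz, stepMean, mul_div_assoc]
  have hκ := kernel_triple_one hs hp hsne h1s (htdef ▸ h1sp) hE
    (by rw [← htdef, ← hr, ← hρ]; exact hmul (hmul hrn hρn) hρn)
  rw [← htdef, ← hr, ← hρ] at hκ
  have m1 := hasCircleMean_kernel (hmul hrn hρn)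
  have m2 := hasCircleMean_kernel (hmul hρn hρn)
  have m3 := hasCircleMean_kernel_mul_kernel (hmul hrn hρn) hρn (w := 1) (by simp)
  have m4 := hasCircleMean_kernel_mul_kernel (hmul hρn hρn) hrn (w := 1) (by simp)
  simp only [mul_one] at m3 m4
  rw [show ρ * ρ * r = r * ρ * ρ by ring, hκ] at m4
  rw [hκ] at m3
  have m5 := hasCircleMean_kernel hrn
  have m6 := hasCircleMean_kernel hρn
  have main : HasCircleMean (fun w => Real.circleAverage (fun z => ratG1 lam z w) 0 1)
      (2 / ((1 - lam ^ 2) * (1 - lam) ^ 2) *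
        ((1 - lam) ^ 2 / (s * p) + 4 * lam / (1 + (1 + lam) * p) + (1 - lam ^ 2) - 2 * s)) := by
    refine ((((((((m1.const_mul ((1 / (1 - lam) - 1) * (s⁻¹ * t⁻¹))).add
      (m2.const_mul ((-1 - lam / (1 - lam)) * t⁻¹ ^ 2))).add
      (m3.const_mul (s⁻¹ * t⁻¹ ^ 2))).add
      (m4.const_mul (s⁻¹ * t⁻¹ ^ 2))).add
      (m5.const_mul (((t⁻¹ - 1) / (1 - lam) - t⁻¹ + lam / (1 - lam) * t⁻¹
        - 1 / (1 - lam) + 1) * s⁻¹))).add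
      (m6.const_mul ((-(t⁻¹ - 1) * lam / (1 - lam) - t⁻¹ + lam / (1 - lam) * s⁻¹
        - 1 / (1 - lam) + 1) * t⁻¹))).add
      (HasCircleMean.const (t⁻¹ + (-lam - 1) / (1 - lam) * s⁻¹ + 2 / (1 - lam) - 1))).const_mul
      (2 / (1 - lam ^ 2))).congr (fun w hw => ?_) ?_
    · have hpf := resolvent_mul_resolvent hlam hw
      rw [hY w hw, hW w hw] at hpf
      rw [(hasCircleMean_ratG1 hlam hw hs hs0 ht hsp0 hr hρ (hY w hw).symm (hW w hw).symm).2]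
      congr 1
      obtain ⟨Q, hQ⟩ : ∃ Q, Q = (1 - lam)⁻¹ := ⟨_, rfl⟩
      simp only [div_eq_mul_inv, ← hQ] at hpf ⊢
      linear_combination (t⁻¹ - 1) * hpf
    · rw [htdef]
      have hE' : 1 + p * (1 + lam) ≠ 0 := by rwa [mul_comm p]
      field_simp
      linear_combination (2 * (lam - 1) * (1 + (1 - lam) * p) - 4 * lam * s ^ 2 * p ^ 2
        + 2 * s ^ 3 * p ^ 2 * (1 + (1 + lam) * p)) * hs
  exact main.2

/-- The second moment of `U`, in closed form. -/
lemma integral_U_sq (hlam : ‖lam‖ < 1) :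
    ∫ x in (-1 : ℝ)..1, U lam x ^ 2 = 2 / ((1 - lam ^ 2) * (1 - lam) ^ 2) *
        ((1 - lam) ^ 2 / Complex.sqrt (1 - lam ^ 4)
          + 4 * lam / (1 + (1 + lam) * Complex.sqrt (1 + lam ^ 2))
          + (1 - lam ^ 2) - 2 * Complex.sqrt (1 - lam ^ 2)) := by
  have hl2 := norm_sq_lt_one hlam
  have h1 := re_one_sub_pos hl2
  have h2 := re_one_add_pos hl2
  rw [integral_U_sq_eq_circleAverage hlam, sqrt_one_sub_pow_four hlam]
  exact circleAverage_circleAverage_ratG1 hlam (sq_sqrt _) (sqrt_re_pos h1) (sq_sqrt _)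
    (sqrt_re_pos h2) (re_mul_pos_of_re_sq_pos (sqrt_re_pos h1) (sqrt_re_pos h2)
      (by rwa [sq_sqrt]) (by rwa [sq_sqrt]))

end LoopCounting

theorem mainTheorem5 (lam : ℂ) (hlam : ‖lam‖ < 1) :
    -- the second moment and its closed form
    IntervalIntegrable (fun x : ℝ => LoopCounting.U lam x ^ 2) MeasureTheory.volume (-1) 1 ∧
    (∫ x in (0 : ℝ)..1, LoopCounting.U lam x ^ 2) =
      1 / ((1 - lam ^ 2) * (1 - lam) ^ 2) *
        ((1 - lam) ^ 2 / Complex.sqrt (1 - lam ^ 4)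
          + 4 * lam / (1 + (1 + lam) * Complex.sqrt (1 + lam ^ 2))
          + (1 - lam ^ 2) - 2 * Complex.sqrt (1 - lam ^ 2)) ∧
    (∫ x in (-1 : ℝ)..1, LoopCounting.U lam x ^ 2) =
      2 / ((1 - lam ^ 2) * (1 - lam) ^ 2) *
        ((1 - lam) ^ 2 / Complex.sqrt (1 - lam ^ 4)
          + 4 * lam / (1 + (1 + lam) * Complex.sqrt (1 + lam ^ 2))
          + (1 - lam ^ 2) - 2 * Complex.sqrt (1 - lam ^ 2)) ∧
    -- the double contour integral of the explicit rational function
    (∀ z w : ℂ, ‖z‖ = 1 → ‖w‖ = 1 →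
      (∫ x in (-1 : ℝ)..1, LoopCounting.G lam x z * LoopCounting.G lam x w) =
        LoopCounting.ratG1 lam z w) ∧
    (∫ x in (-1 : ℝ)..1, LoopCounting.U lam x ^ 2) =
      1 / (2 * Real.pi * Complex.I) ^ 2 *
        ∮ w in C(0, 1), ∮ z in C(0, 1), LoopCounting.ratG1 lam z w / (z * w) := by
  have hfull := LoopCounting.integral_U_sq hlam
  refine ⟨LoopCounting.intervalIntegrable_U_sq hlam _ _, ?_, hfull,
    fun z w hz hw => LoopCounting.integral_G_mul_G hlam hz hw, ?_⟩
  · rw [LoopCounting.integral_U_sq_eq_two_mul hlam] at hfull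
    refine mul_left_cancel₀ (two_ne_zero (α := ℂ)) ?_
    rw [hfull]
    ring
  · rw [LoopCounting.integral_U_sq_eq_circleAverage hlam,
      LoopCounting.circleAverage_circleAverage_eq]
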